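/- Let $p$ be an odd prime, $m$ a positive integer, $q=p^m$, and let $\mathrm{Tr}$ be the trace from $\mathrm{GF}(q)$ to $\mathrm{GF}(p)$. Let $$\mathcal C=\{(\mathrm{Tr}(ax^2+bx+c))_{x\in \mathrm{GF}(q)} : a,b,c\in \mathrm{GF}(q)\},$$ a linear code over $\mathrm{GF}(p)$ whose coordinates are indexed by $\mathrm{GF}(q)$. For a set $T\subseteq \mathrm{GF}(q)$ of coordinate positions, the shortened code $\mathcal C_T$ is obtained by taking all codewords of $\mathcal C$ that vanish on $T$ and deleting their coordinates in $T$. An $[n,k]$ code is a linear code of length $n$ and dimension $k$. Then $\mathcal C$ is a $[p^m,2m+1]$ code, and the following holds. In each table below, the listed entries are (weight: number of codewords of this weight), and there are no codewords of any weight that is not listed. (1) If $\#T=1$, then $\mathcal C_T$ is a $[p^m-1,2m]$ code over $\mathrm{GF}(p)$. If $m$ is odd, its weight distribution is - $0$: $1$ - $p^{m-1}(p-1)$: $(p^m-1)(1+p^{m-1})$ - $p^{m-1}(p-1)-p^{(m-1)/2}$: $\frac12(p-1)p^{(m-3)/2}(p^m-1)\left(p+p^{(1+m)/2}\right)$ -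 $p^{m-1}(p-1)+p^{(m-1)/2}$: $\frac12(p-1)p^{(m-3)/2}(p^m-1)\left(-p+p^{(1+m)/2}\right)$ If $m$ is even, its weight distribution is - $0$: $1$ - $(p-1)\left(p^{m-1}-p^{(m-2)/2}\right)$: $\frac12p^{m/2-1}\left(p+p^{m/2}-1\right)(p^m-1)$ - $(p-1)p^{m-1}-p^{(m-2)/2}$: $\frac12(p-1)p^{m/2-1}\left(p^{m/2}-1\right)\left(1+p^{m/2}\right)^2$ - $(p-1)p^{m-1}$: $p^m-1$ - $(p-1)p^{m-1}+p^{(m-2)/2}$: $\frac12(p-1)p^{m/2-1}\left(p^{m/2}-1\right)^2\left(1+p^{m/2}\right)$ - $(p-1)\left(p^{m-1}+p^{(m-2)/2}\right)$: $\frac12p^{m/2-1}\left(-p+p^{m/2}+1\right)(p^m-1)$ (2) If $\#T=2$, then $\mathcal C_T$ is a $[p^m-2,2m-1]$ code over $\mathrm{GF}(p)$. If $m$ is odd, its weight distribution is - $0$: $1$ - $p^{m-1}(p-1)$: $p^{2m-2}-1$ - $p^{m-1}(p-1)-p^{(m-1)/2}$: $\frac12(p-1)\left(-p^{(m-1)/2}+p^{2m-2}+2p^{(3m-3)/2}\right)$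 - $p^{m-1}(p-1)+p^{(m-1)/2}$: $\frac12(p-1)\left(p^{(m-1)/2}+p^{2m-2}-2p^{(3m-3)/2}\right)$ If $m$ is even, its weight distribution is - $0$: $1$ - $(p-1)\left(p^{m-1}-p^{(m-2)/2}\right)$: $\frac12p^{m/2-2}\left(p^{m/2}-1\right)\left(-1+p+p^{m/2}\right)\left(p+p^{m/2}\right)$ - $(p-1)p^{m-1}-p^{(m-2)/2}$: $\frac12(p-1)p^{m/2-2}\left(1+p^{m/2}\right)\left(-p+p^{m/2}+p^m\right)$ - $(p-1)p^{m-1}$: $p^{m-1}-1$ - $(p-1)p^{m-1}+p^{(m-2)/2}$: $\frac12(p-1)p^{m/2-2}\left(-1+p^{m/2}\right)\left(-p-p^{m/2}+p^m\right)$ - $(p-1)\left(p^{m-1}+p^{(m-2)/2}\right)$: $\frac12p^{m/2-2}\left(p^{m/2}+1\right)\left(1-p+p^{m/2}\right)\left(p^{m/2}-p\right)$ -/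

import Mathlib

namespace CodeShortening

/-- The code of length `#F` over `GF(p)`, with coordinates indexed by the elements of `F`, that
consists of the words `(Tr (a f(x) + b x + c))_{x ∈ F}` with `a, b, c ∈ F`; here `Tr` is the trace
from `F` to `GF(p)`. -/
def traceCode (p : ℕ) [Fact p.Prime] {F : Type*} [Field F] [Algebra (ZMod p) F]
    (f : Polynomial F) : Submodule (ZMod p) (F → ZMod p) where
  carrier := {v | ∃ a b c : F,
    v = fun x => Algebra.trace (ZMod p) F (a * f.eval x + b * x + c)}
  zero_mem' := ⟨0, 0, 0, by funext x; simp⟩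
  add_mem' := by
    rintro _ _ ⟨a, b, c, rfl⟩ ⟨a', b', c', rfl⟩
    refine ⟨a + a', b + b', c + c', ?_⟩
    funext x
    simp only [Pi.add_apply, ← map_add]
    congr 1
    ring
  smul_mem' := by
    rintro r _ ⟨a, b, c, rfl⟩
    refine ⟨r • a, r • b, r • c, ?_⟩
    funext x
    simp only [Pi.smul_apply, ← map_smul, smul_add, smul_mul_assoc]

/-- The subcode `C(T)` of the words of `C` that vanish at all the positions in `T`. -/
def vanishingSubcode {K ι : Type*} [Field K] (C : Submodule K (ι → K)) (T : Finset ι) :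
    Submodule K (ι → K) where
  carrier := {v | v ∈ C ∧ ∀ i ∈ T, v i = 0}
  zero_mem' := ⟨C.zero_mem, fun _ _ => rfl⟩
  add_mem' := by
    rintro u v ⟨hu, hu'⟩ ⟨hv, hv'⟩
    exact ⟨C.add_mem hu hv, fun i hi => by simp [hu' i hi, hv' i hi]⟩
  smul_mem' := by
    rintro r v ⟨hv, hv'⟩
    exact ⟨C.smul_mem r hv, fun i hi => by simp [hv' i hi]⟩

/-- Puncturing `C` on `T`: delete the coordinates in `T` from every word of `C`. -/
def puncture {K ι : Type*} [Field K] (C : Submodule K (ι → K)) (T : Finset ι) :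
    Submodule K ({i : ι // i ∉ T} → K) :=
  C.map (LinearMap.funLeft K K (Subtype.val : {i : ι // i ∉ T} → ι))

/-- The shortened code `C_T`: puncture on `T` the subcode of the words of `C` that vanish
on `T`. -/
def shorten {K ι : Type*} [Field K] (C : Submodule K (ι → K)) (T : Finset ι) :
    Submodule K ({i : ι // i ∉ T} → K) :=
  puncture (vanishingSubcode C T) T

/-- `C` is an `[n, k]` linear code over `K`. -/
def IsLinearCode {K ι : Type*} [Field K] [Fintype ι] (C : Submodule K (ι → K)) (n k : ℕ) : Prop :=
  Fintype.card ι = n ∧ Module.finrank K C = k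

/-- `A_w`: the number of words of Hamming weight `w` in `C`. -/
noncomputable def weightCount {K ι : Type*} [Field K] [DecidableEq K] [Fintype ι]
    (C : Submodule K (ι → K)) (w : ℕ) : ℕ :=
  Set.ncard {v : ι → K | v ∈ C ∧ hammingNorm v = w}

/-- `C` has the weight distribution given by a table with rows (weight, multiplicity): for every
`w`, the number of words of weight `w` is the multiplicity listed for `w`, and it is `0` if `w` is
not listed (if several rows had the same weight, their multiplicities would be added). -/
def HasWeightDistribution {K ι : Type*} [Field K] [DecidableEq K] [Fintype ι]
    (C : Submodule K (ι → K)) (table : List (ℤ × ℚ)) : Prop :=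
  ∀ w : ℕ, (weightCount C w : ℚ) = ((table.filter fun r => r.1 = (w : ℤ)).map Prod.snd).sum

/-- The table for `m` odd and one shortened coordinate. For odd `m` the divisions by `2` in the
exponents are exact; negative exponents occur only for `m = 1`. -/
def tableOddOne (p m : ℕ) : List (ℤ × ℚ) :=
  [ (0, 1),
    ((p : ℤ) ^ (m - 1) * (p - 1),
      ((p : ℚ) ^ m - 1) * (1 + (p : ℚ) ^ (m - 1))),
    ((p : ℤ) ^ (m - 1) * (p - 1) - (p : ℤ) ^ ((m - 1) / 2),
      1 / 2 * ((p : ℚ) - 1) * (p : ℚ) ^ (((m : ℤ) - 3) / 2) * ((p : ℚ) ^ m - 1) *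
        ((p : ℚ) + (p : ℚ) ^ ((1 + m) / 2))),
    ((p : ℤ) ^ (m - 1) * (p - 1) + (p : ℤ) ^ ((m - 1) / 2),
      1 / 2 * ((p : ℚ) - 1) * (p : ℚ) ^ (((m : ℤ) - 3) / 2) * ((p : ℚ) ^ m - 1) *
        (-(p : ℚ) + (p : ℚ) ^ ((1 + m) / 2))) ]

/-- The table for `m` odd and two shortened coordinates. -/
def tableOddTwo (p m : ℕ) : List (ℤ × ℚ) :=
  [ (0, 1),
    ((p : ℤ) ^ (m - 1) * (p - 1),
      (p : ℚ) ^ (2 * m - 2) - 1),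
    ((p : ℤ) ^ (m - 1) * (p - 1) - (p : ℤ) ^ ((m - 1) / 2),
      ((p : ℚ) - 1) *
        (-(p : ℚ) ^ ((m - 1) / 2) + (p : ℚ) ^ (2 * m - 2) + 2 * (p : ℚ) ^ ((3 * m - 3) / 2)) / 2),
    ((p : ℤ) ^ (m - 1) * (p - 1) + (p : ℤ) ^ ((m - 1) / 2),
      ((p : ℚ) - 1) *
        ((p : ℚ) ^ ((m - 1) / 2) + (p : ℚ) ^ (2 * m - 2) - 2 * (p : ℚ) ^ ((3 * m - 3) / 2)) / 2) ]

/-- The table for `m` even and one shortened coordinate. -/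
def tableEvenOne (p m : ℕ) : List (ℤ × ℚ) :=
  [ (0, 1),
    (((p : ℤ) - 1) * ((p : ℤ) ^ (m - 1) - (p : ℤ) ^ ((m - 2) / 2)),
      (p : ℚ) ^ (m / 2 - 1) * ((p : ℚ) + (p : ℚ) ^ (m / 2) - 1) * ((p : ℚ) ^ m - 1) / 2),
    (((p : ℤ) - 1) * (p : ℤ) ^ (m - 1) - (p : ℤ) ^ ((m - 2) / 2),
      ((p : ℚ) - 1) * (p : ℚ) ^ (m / 2 - 1) * ((p : ℚ) ^ (m / 2) - 1) *
        (1 + (p : ℚ) ^ (m / 2)) ^ 2 / 2),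
    (((p : ℤ) - 1) * (p : ℤ) ^ (m - 1),
      (p : ℚ) ^ m - 1),
    (((p : ℤ) - 1) * (p : ℤ) ^ (m - 1) + (p : ℤ) ^ ((m - 2) / 2),
      ((p : ℚ) - 1) * (p : ℚ) ^ (m / 2 - 1) * ((p : ℚ) ^ (m / 2) - 1) ^ 2 *
        (1 + (p : ℚ) ^ (m / 2)) / 2),
    (((p : ℤ) - 1) * ((p : ℤ) ^ (m - 1) + (p : ℤ) ^ ((m - 2) / 2)),
      (p : ℚ) ^ (m / 2 - 1) * (-(p : ℚ) + (p : ℚ) ^ (m / 2) + 1) * ((p : ℚ) ^ m - 1) / 2) ]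

/-- The table for `m` even and two shortened coordinates. For even `m` the divisions by `2` in the
exponents are exact; negative exponents occur only for `m = 2`. -/
def tableEvenTwo (p m : ℕ) : List (ℤ × ℚ) :=
  [ (0, 1),
    (((p : ℤ) - 1) * ((p : ℤ) ^ (m - 1) - (p : ℤ) ^ ((m - 2) / 2)),
      (p : ℚ) ^ ((m : ℤ) / 2 - 2) * ((p : ℚ) ^ (m / 2) - 1) * (-1 + (p : ℚ) + (p : ℚ) ^ (m / 2)) *
        ((p : ℚ) + (p : ℚ) ^ (m / 2)) / 2),
    (((p : ℤ) - 1) * (p : ℤ) ^ (m - 1) - (p : ℤ) ^ ((m - 2) / 2),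
      ((p : ℚ) - 1) * (p : ℚ) ^ ((m : ℤ) / 2 - 2) * (1 + (p : ℚ) ^ (m / 2)) *
        (-(p : ℚ) + (p : ℚ) ^ (m / 2) + (p : ℚ) ^ m) / 2),
    (((p : ℤ) - 1) * (p : ℤ) ^ (m - 1),
      (p : ℚ) ^ (m - 1) - 1),
    (((p : ℤ) - 1) * (p : ℤ) ^ (m - 1) + (p : ℤ) ^ ((m - 2) / 2),
      ((p : ℚ) - 1) * (p : ℚ) ^ ((m : ℤ) / 2 - 2) * (-1 + (p : ℚ) ^ (m / 2)) *
        (-(p : ℚ) - (p : ℚ) ^ (m / 2) + (p : ℚ) ^ m) / 2),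
    (((p : ℤ) - 1) * ((p : ℤ) ^ (m - 1) + (p : ℤ) ^ ((m - 2) / 2)),
      (p : ℚ) ^ ((m : ℤ) / 2 - 2) * ((p : ℚ) ^ (m / 2) + 1) * (1 - (p : ℚ) + (p : ℚ) ^ (m / 2)) *
        ((p : ℚ) ^ (m / 2) - (p : ℚ)) / 2) ]

end CodeShortening

/-! The affine maps `x ↦ αx + β` with `α ≠ 0` act doubly transitively on the coordinates and
preserve the code, since substituting them into a polynomial of degree at most 2 gives another one.
So the number of words of weight `w` vanishing on `T` depends only on `#T` when `#T ≤ 2`. With `n =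
p^m`, double counting the pairs (zero position, word), or (ordered pair of zeros, word), gives
`A_w(C_T) = (n-w)/n · A_w(C)` for `#T = 1` and `A_w(C_T) = (n-w)(n-w-1)/(n(n-1)) · A_w(C)` for `#T =
2` (`card_mul_weightCount_shorten_singleton`, `card_mul_weightCount_shorten_pair`). It remains to
find the weights of `C` itself.

With `τ = Tr c`, the triples `(a, b, τ)` parametrize `C` bijectively. If `a ≠ 0`, completing the
square reduces to `b = 0`, and character orthogonality expresses the number of zeros of `Tr(ax²) +
τ` through quadratic Gauss sums. The square of a Gauss sum is known, so only a global sign `s` stays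
unknown. It does not matter, because the quadratic character takes the values `1` and `-1` equally
often. The parity of `m` enters through the restriction of the quadratic character to `GF(p)`: it is
trivial on nonzero elements for even `m`, and is the quadratic character of `GF(p)` for odd `m`.

Scaling the table of `C` row by row gives all four tables. The row of the nonzero constant words, of
weight `n`, is scaled to zero and disappears. -/

namespace CodeShortening

/-! ### Shortening of general codes and double counting under double transitivity. -/

section GeneralCodes

variable {K ι : Type*} [Field K]

theorem mem_shorten_iff {C : Submodule K (ι → K)} {T : Finset ι} {u : {i : ι // i ∉ T} → K} :
    u ∈ shorten C T ↔ ∃ v ∈ C, (∀ i ∈ T, v i = 0) ∧ (fun i : {i : ι // i ∉ T} => v i) = u := by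
  constructor
  · rintro ⟨v, ⟨hv, hT⟩, rfl⟩
    exact ⟨v, hv, hT, rfl⟩
  · rintro ⟨v, hv, hT, rfl⟩
    exact ⟨v, ⟨hv, hT⟩, rfl⟩

theorem eq_of_restrict_eq {T : Finset ι} {u v : ι → K} (hu : ∀ i ∈ T, u i = 0)
    (hv : ∀ i ∈ T, v i = 0)
    (h : (fun i : {i : ι // i ∉ T} => u i) = fun i : {i : ι // i ∉ T} => v i) : u = v := by
  funext i
  by_cases hi : i ∈ T
  · rw [hu i hi, hv i hi]
  · exact congrFun h ⟨i, hi⟩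

theorem finrank_shorten (C : Submodule K (ι → K)) (T : Finset ι) :
    Module.finrank K (shorten C T) = Module.finrank K (vanishingSubcode C T) := by
  unfold shorten puncture
  rw [← LinearMap.range_domRestrict]
  apply LinearMap.finrank_range_of_inj
  rintro ⟨u, hu⟩ ⟨v, hv⟩ h
  exact Subtype.ext (eq_of_restrict_eq hu.2 hv.2 h)

/-- The subcode is the kernel of the evaluation functional at `i`, which is nonzero on `C` by
hypothesis. -/
theorem finrank_vanishingSubcode_singleton [Finite ι] (C : Submodule K (ι → K)) (i : ι)
    (h : ∃ v ∈ C, v i ≠ 0) :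
    Module.finrank K (vanishingSubcode C {i}) + 1 = Module.finrank K C := by
  let f : Module.Dual K C := (LinearMap.proj i : (ι → K) →ₗ[K] K) ∘ₗ C.subtype
  have hf : f ≠ 0 := by
    obtain ⟨v, hv, hvi⟩ := h
    intro h0
    exact hvi (LinearMap.congr_fun h0 ⟨v, hv⟩)
  have hmap : vanishingSubcode C {i} = (LinearMap.ker f).map C.subtype := by
    ext v
    constructor
    · rintro ⟨hv, hi⟩
      exact ⟨⟨v, hv⟩, hi i (Finset.mem_singleton_self i), rfl⟩
    · rintro ⟨⟨v, hv⟩, hi, rfl⟩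
      refine ⟨hv, fun j hj => ?_⟩
      rw [Finset.mem_singleton.mp hj]
      exact hi
  rw [hmap, Submodule.finrank_map_subtype_eq, Module.Dual.finrank_ker_add_one_of_ne_zero hf]

theorem vanishingSubcode_pair [DecidableEq ι] (C : Submodule K (ι → K)) (i j : ι) :
    vanishingSubcode C {i, j} = vanishingSubcode (vanishingSubcode C {i}) {j} := by
  ext v
  change (v ∈ C ∧ ∀ k ∈ ({i, j} : Finset ι), v k = 0) ↔
    (v ∈ C ∧ ∀ k ∈ ({i} : Finset ι), v k = 0) ∧ ∀ k ∈ ({j} : Finset ι), v k = 0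
  simp [and_assoc]

variable [DecidableEq K] [Fintype ι]

theorem hammingNorm_restrict [DecidableEq ι] {T : Finset ι} {v : ι → K}
    (hv : ∀ i ∈ T, v i = 0) :
    hammingNorm (fun i : {i : ι // i ∉ T} => v i) = hammingNorm v := by
  unfold hammingNorm
  rw [← Finset.card_map (Function.Embedding.subtype fun i => i ∉ T)]
  congr 1
  ext i
  simp only [Finset.mem_map, Finset.mem_filter, Finset.mem_univ, true_and,
    Function.Embedding.subtype_apply, Subtype.exists, exists_and_left, exists_prop,
    exists_eq_right_right]
  exact ⟨fun h => h.1, fun h => ⟨h, fun hi => h (hv i hi)⟩⟩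

theorem weightCount_shorten [DecidableEq ι] (C : Submodule K (ι → K)) (T : Finset ι) (w : ℕ) :
    weightCount (shorten C T) w =
      Set.ncard {v : ι → K | (v ∈ C ∧ hammingNorm v = w) ∧ ∀ i ∈ T, v i = 0} := by
  unfold weightCount
  rw [← Set.InjOn.ncard_image (f := fun (v : ι → K) (i : {i : ι // i ∉ T}) => v i)]
  · congr 1
    ext u
    simp only [Set.mem_ofPred_eq, Set.mem_image, mem_shorten_iff]
    constructor
    · rintro ⟨⟨v, hv, hT, rfl⟩, hw⟩
      exact ⟨v, ⟨⟨hv, by rw [← hw, hammingNorm_restrict hT]⟩, hT⟩, rfl⟩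
    · rintro ⟨v, ⟨⟨hv, hw⟩, hT⟩, rfl⟩
      exact ⟨⟨v, hv, hT, rfl⟩, by rw [hammingNorm_restrict hT, hw]⟩
  · exact fun u hu v hv h => eq_of_restrict_eq hu.2 hv.2 h

/-- A code is doubly transitive if any two ordered pairs of distinct positions are exchanged by a
permutation of the positions that maps the code into itself. -/
def IsDoublyTransitive (C : Submodule K (ι → K)) : Prop :=
  ∀ i j k l : ι, i ≠ j → k ≠ l →
    ∃ σ : Equiv.Perm ι, σ i = k ∧ σ j = l ∧ ∀ v ∈ C, v ∘ σ ∈ C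

theorem hammingNorm_comp_perm (σ : Equiv.Perm ι) (v : ι → K) :
    hammingNorm (v ∘ σ) = hammingNorm v := by
  unfold hammingNorm
  refine Finset.card_bij (fun i _ => σ i) (by simp) (by simp) ?_
  intro i hi
  exact ⟨σ.symm i, by simpa using hi, by simp⟩

theorem card_zeros_add_hammingNorm (v : ι → K) :
    (Finset.univ.filter fun i => v i = 0).card + hammingNorm v = Fintype.card ι := by
  unfold hammingNorm
  rw [Finset.card_filter_add_card_filter_not, Finset.card_univ]

variable [Fintype K]

open Classical in
theorem weightCount_eq_card (C : Submodule K (ι → K)) (w : ℕ) :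
    weightCount C w = (Finset.univ.filter fun v : ι → K => v ∈ C ∧ hammingNorm v = w).card := by
  unfold weightCount
  rw [← Set.ncard_coe_finset]
  congr 1
  ext v
  simp

open Classical in
theorem weightCount_shorten_eq_card [DecidableEq ι] (C : Submodule K (ι → K)) (T : Finset ι)
    (w : ℕ) : weightCount (shorten C T) w = ((Finset.univ.filter fun v : ι → K =>
      v ∈ C ∧ hammingNorm v = w).filter fun v => ∀ i ∈ T, v i = 0).card := by
  rw [weightCount_shorten, ← Set.ncard_coe_finset]
  congr 1
  ext v
  simp

/-- Composition with the permutation injects the words vanishing at `k, l` into those vanishing at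
`i, j`. Exchanging the pairs turns the inequality into an equality. -/
theorem IsDoublyTransitive.weightCount_shorten_pair_le [DecidableEq ι]
    {C : Submodule K (ι → K)} (hC : IsDoublyTransitive C) {i j k l : ι} (hij : i ≠ j)
    (hkl : k ≠ l) (w : ℕ) :
    weightCount (shorten C {k, l}) w ≤ weightCount (shorten C {i, j}) w := by
  classical
  obtain ⟨σ, hi, hj, hσ⟩ := hC i j k l hij hkl
  rw [weightCount_shorten_eq_card, weightCount_shorten_eq_card]
  refine Finset.card_le_card_of_injOn (fun v => v ∘ σ) ?_ ?_
  · intro v hv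
    simp only [Finset.coe_filter, Finset.mem_filter, Finset.mem_univ, true_and,
      Finset.mem_insert, Finset.mem_singleton, forall_eq_or_imp, forall_eq,
      Set.mem_ofPred_eq] at hv ⊢
    exact ⟨⟨hσ v hv.1.1, by rw [hammingNorm_comp_perm, hv.1.2]⟩, by simp [hi, hv.2.1],
      by simp [hj, hv.2.2]⟩
  · intro u _ v _ h
    exact σ.surjective.injective_comp_right h

theorem IsDoublyTransitive.weightCount_shorten_singleton_le [DecidableEq ι] [Nontrivial ι]
    {C : Submodule K (ι → K)} (hC : IsDoublyTransitive C) (i k : ι) (w : ℕ) :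
    weightCount (shorten C {k}) w ≤ weightCount (shorten C {i}) w := by
  classical
  obtain ⟨j, hj⟩ := exists_ne i
  obtain ⟨l, hl⟩ := exists_ne k
  obtain ⟨σ, hi, -, hσ⟩ := hC i j k l hj.symm hl.symm
  rw [weightCount_shorten_eq_card, weightCount_shorten_eq_card]
  refine Finset.card_le_card_of_injOn (fun v => v ∘ σ) ?_ ?_
  · intro v hv
    simp only [Finset.coe_filter, Finset.mem_filter, Finset.mem_univ, true_and,
      Finset.mem_singleton, forall_eq, Set.mem_ofPred_eq] at hv ⊢
    exact ⟨⟨hσ v hv.1.1, by rw [hammingNorm_comp_perm, hv.1.2]⟩, by simp [hi, hv.2]⟩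
  · intro u _ v _ h
    exact σ.surjective.injective_comp_right h

theorem IsDoublyTransitive.card_mul_weightCount_shorten_singleton [DecidableEq ι] [Nontrivial ι]
    {C : Submodule K (ι → K)} (hC : IsDoublyTransitive C) (i : ι) (w : ℕ) :
    (Fintype.card ι : ℚ) * weightCount (shorten C {i}) w =
      ((Fintype.card ι : ℚ) - w) * weightCount C w := by
  classical
  -- Count the pairs (position, word of weight `w` vanishing there). Each position contributes the
  -- same number, and each word has `n - w` zeros.
  have h := Finset.sum_card_bipartiteAbove_eq_sum_card_bipartiteBelow
    (s := (Finset.univ : Finset ι))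
    (t := Finset.univ.filter fun v : ι → K => v ∈ C ∧ hammingNorm v = w) fun k v => v k = 0
  have h1 : ∀ k : ι, (Finset.bipartiteAbove (fun k (v : ι → K) => v k = 0)
      (Finset.univ.filter fun v : ι → K => v ∈ C ∧ hammingNorm v = w) k).card =
      weightCount (shorten C {i}) w := by
    intro k
    rw [le_antisymm (hC.weightCount_shorten_singleton_le k i w)
      (hC.weightCount_shorten_singleton_le i k w), weightCount_shorten_eq_card]
    simp [Finset.bipartiteAbove]
  rw [Finset.sum_congr rfl fun k _ => h1 k, Finset.sum_const, Finset.card_univ,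
    smul_eq_mul] at h
  rw [← Nat.cast_mul, h, Nat.cast_sum, weightCount_eq_card, mul_comm, ← nsmul_eq_mul,
    ← Finset.sum_const]
  refine Finset.sum_congr (by ext; simp) fun v hv => ?_
  rw [← card_zeros_add_hammingNorm v, (Finset.mem_filter.mp hv).2.2]
  simp [Finset.bipartiteBelow]

theorem IsDoublyTransitive.card_mul_weightCount_shorten_pair [DecidableEq ι]
    {C : Submodule K (ι → K)} (hC : IsDoublyTransitive C) {i j : ι} (hij : i ≠ j) (w : ℕ) :
    (Fintype.card ι : ℚ) * (Fintype.card ι - 1) * weightCount (shorten C {i, j}) w =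
      ((Fintype.card ι : ℚ) - w) * (Fintype.card ι - w - 1) * weightCount C w := by
  classical
  -- The same count over ordered pairs of distinct positions: a word with `z = n - w` zeros
  -- contributes `z(z-1)`.
  have h := Finset.sum_card_bipartiteAbove_eq_sum_card_bipartiteBelow
    (s := (Finset.univ : Finset ι).offDiag)
    (t := Finset.univ.filter fun v : ι → K => v ∈ C ∧ hammingNorm v = w)
    fun k v => v k.1 = 0 ∧ v k.2 = 0
  have h1 : ∀ k ∈ (Finset.univ : Finset ι).offDiag,
      (Finset.bipartiteAbove (fun k (v : ι → K) => v k.1 = 0 ∧ v k.2 = 0)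
      (Finset.univ.filter fun v : ι → K => v ∈ C ∧ hammingNorm v = w) k).card =
      weightCount (shorten C {i, j}) w := by
    intro k hk
    have hk' : k.1 ≠ k.2 := by simpa using hk
    rw [le_antisymm (hC.weightCount_shorten_pair_le hk' hij w)
      (hC.weightCount_shorten_pair_le hij hk' w), weightCount_shorten_eq_card]
    simp [Finset.bipartiteAbove]
  have hcard : ∀ s : Finset ι, (s.offDiag.card : ℚ) = s.card * (s.card - 1) := by
    intro s
    rw [Finset.offDiag_card, Nat.cast_sub (Nat.le_mul_self _)]
    push_cast
    ring
  rw [Finset.sum_congr rfl h1, Finset.sum_const, smul_eq_mul] at h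
  rw [← Finset.card_univ, ← hcard, ← Nat.cast_mul, h, Nat.cast_sum, weightCount_eq_card,
    mul_comm, ← nsmul_eq_mul, ← Finset.sum_const]
  refine Finset.sum_congr (by ext; simp) fun v hv => ?_
  have h2 : Finset.bipartiteBelow (fun (k : ι × ι) (v : ι → K) => v k.1 = 0 ∧ v k.2 = 0)
      (Finset.univ : Finset ι).offDiag v = (Finset.univ.filter fun i => v i = 0).offDiag := by
    ext k
    simp only [Finset.bipartiteBelow, Finset.mem_filter, Finset.mem_offDiag, Finset.mem_univ,
      true_and]
    tauto
  rw [h2, hcard, Finset.card_univ, ← card_zeros_add_hammingNorm v, (Finset.mem_filter.mp hv).2.2]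
  push_cast
  ring

end GeneralCodes

/-! ### Gauss sums and the zeros of `Tr(ax²) + τ`. -/

section QuadraticSums

open AddChar

/-- The restriction of a multiplicative character of `F` to a subfield `K`. -/
def restrictChar (K : Type*) {F R : Type*} [Field K] [Field F] [Algebra K F] [CommRing R]
    (χ : MulChar F R) : MulChar K R where
  toMonoidHom := χ.toMonoidHom.comp (algebraMap K F : K →* F)
  map_nonunit' := fun a ha => by
    have : a = 0 := by simpa using ha
    subst this
    change χ (algebraMap K F 0) = 0
    rw [map_zero, MulChar.map_zero]

theorem restrictChar_apply {K F R : Type*} [Field K] [Field F] [Algebra K F] [CommRing R]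
    (χ : MulChar F R) (y : K) : restrictChar K χ y = χ (algebraMap K F y) := rfl

section TraceChar

variable {F : Type*} [Field F] {p : ℕ} [Fact p.Prime] [Algebra (ZMod p) F]

theorem exists_trace_mul_ne_zero [Finite F] {a : F} (ha : a ≠ 0) :
    ∃ b : F, Algebra.trace (ZMod p) F (a * b) ≠ 0 := by
  by_contra! hf
  exact ha ((traceForm_nondegenerate (ZMod p) F).1 a hf)

variable (F p) in
/-- The canonical additive character of `F`. -/
noncomputable def traceChar : AddChar F ℂ :=
  (ZMod.stdAddChar (N := p)).compAddMonoidHom (Algebra.trace (ZMod p) F).toAddMonoidHom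

theorem traceChar_apply (x : F) :
    traceChar F p x = ZMod.stdAddChar (Algebra.trace (ZMod p) F x) := rfl

theorem traceChar_isPrimitive [Finite F] : (traceChar F p).IsPrimitive := by
  intro a ha h
  obtain ⟨b, hb⟩ := exists_trace_mul_ne_zero (p := p) ha
  have h1 : ZMod.stdAddChar (Algebra.trace (ZMod p) F (a * b)) = 1 := by
    simpa [traceChar_apply] using DFunLike.congr_fun h b
  rw [← map_zero_eq_one (ZMod.stdAddChar (N := p))] at h1
  exact hb (ZMod.injective_stdAddChar h1)

end TraceChar

variable {F : Type*} [Field F] [Fintype F] [DecidableEq F]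

/-- The quadratic character of a finite field with complex values. -/
noncomputable abbrev complexQuadraticChar (F : Type*) [Field F] [Fintype F] [DecidableEq F] :
    MulChar F ℂ :=
  (quadraticChar F).ringHomComp (Int.castRingHom ℂ)

theorem complexQuadraticChar_apply (a : F) :
    complexQuadraticChar F a = (quadraticChar F a : ℂ) := rfl

theorem complexQuadraticChar_ne_one (h2 : ringChar F ≠ 2) : complexQuadraticChar F ≠ 1 :=
  (MulChar.ringHomComp_ne_one_iff (Int.cast_injective)).mpr (quadraticChar_ne_one h2)

/-- `∑ x, ψ (c x²) = η(c) G(η, ψ)` for `c ≠ 0`. -/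
theorem sum_addChar_mul_sq (h2 : ringChar F ≠ 2) {ψ : AddChar F ℂ} (hψ : ψ.IsPrimitive) {c : F}
    (hc : c ≠ 0) :
    ∑ x, ψ (c * x ^ 2) = quadraticChar F c * gaussSum (complexQuadraticChar F) ψ := by
  -- An element `u` has `η(u) + 1` square roots. The summand `1` leads to a complete character sum,
  -- which vanishes (`h3`).
  have h1 : ∑ x, ψ (c * x ^ 2) = ∑ u, ((quadraticChar F u : ℂ) + 1) * ψ (c * u) := by
    rw [← Finset.sum_fiberwise Finset.univ (fun x : F => x ^ 2)]
    refine Finset.sum_congr rfl fun u _ => ?_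
    rw [Finset.sum_congr rfl (g := fun _ => ψ (c * u))
      (fun x hx => by rw [(Finset.mem_filter.mp hx).2]), Finset.sum_const, nsmul_eq_mul]
    congr 1
    have := quadraticChar_card_sqrts h2 u
    rw [Set.toFinset_ofPred] at this
    exact_mod_cast congrArg (Int.cast : ℤ → ℂ) this
  have h3 : ∑ u, ψ (c * u) = 0 := by
    have := sum_mulShift c hψ
    rw [if_neg hc] at this
    rw [← Nat.cast_zero, ← this]
    exact Finset.sum_congr rfl fun u _ => by rw [mul_comm]
  have h4 := gaussSum_mulShift_eq (complexQuadraticChar F) ψ (Units.mk0 c hc)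
  rw [((quadraticChar_isQuadratic F).comp _).inv] at h4
  simp_rw [h1, add_mul, Finset.sum_add_distrib, one_mul, h3, add_zero]
  exact h4

variable {p : ℕ} [Fact p.Prime] [Algebra (ZMod p) F]

/-- Orthogonality: the sum over `y` detects `v i = 0`. -/
theorem card_mul_card_zeros {ι : Type*} [Fintype ι] (v : ι → ZMod p) :
    (p : ℂ) * (Finset.univ.filter fun i => v i = 0).card =
      ∑ y : ZMod p, ∑ i, ZMod.stdAddChar (y * v i) := by
  rw [Finset.sum_comm]
  simp_rw [sum_mulShift _ (ZMod.isPrimitive_stdAddChar p), ZMod.card]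
  push_cast
  rw [← Finset.sum_filter, Finset.sum_const, nsmul_eq_mul, mul_comm]

/-- In the orthogonality sum, `y = 0` gives the main term `#F`. For `y ≠ 0` the sum over `x` is the
Gauss sum times `η(ya)`, and `η` is multiplicative. -/
theorem card_mul_card_zeros_square (h2 : ringChar F ≠ 2) {a : F} (ha : a ≠ 0) (τ : ZMod p) :
    (p : ℂ) * (Finset.univ.filter fun x : F =>
        Algebra.trace (ZMod p) F (a * x ^ 2) + τ = 0).card =
      Fintype.card F + quadraticChar F a * gaussSum (complexQuadraticChar F) (traceChar F p) *
        ∑ y : ZMod p, restrictChar (ZMod p) (quadraticChar F) y * ZMod.stdAddChar (y * τ) := by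
  rw [card_mul_card_zeros]
  have h1 : ∀ y : ZMod p,
      ∑ x : F, ZMod.stdAddChar (y * (Algebra.trace (ZMod p) F (a * x ^ 2) + τ)) =
        (if y = 0 then (Fintype.card F : ℂ) else 0) +
          quadraticChar F a * gaussSum (complexQuadraticChar F) (traceChar F p) *
          (restrictChar (ZMod p) (quadraticChar F) y * ZMod.stdAddChar (y * τ)) := by
    intro y
    by_cases hy : y = 0
    · subst hy
      simp [-quadraticChar_apply, MulChar.map_zero]
    have hya : algebraMap (ZMod p) F y * a ≠ 0 := mul_ne_zero (by simpa using hy) ha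
    have h3 := sum_addChar_mul_sq h2 (traceChar_isPrimitive (p := p)) hya
    rw [map_mul] at h3
    rw [if_neg hy, zero_add, restrictChar_apply]
    push_cast at h3
    have h4 : ∀ x : F, ZMod.stdAddChar (y * (Algebra.trace (ZMod p) F (a * x ^ 2) + τ)) =
        traceChar F p (algebraMap (ZMod p) F y * a * x ^ 2) * ZMod.stdAddChar (y * τ) := by
      intro x
      rw [traceChar_apply, mul_assoc, ← Algebra.smul_def, map_smul, smul_eq_mul, mul_add,
        map_add_eq_mul]
    simp_rw [h4, ← Finset.sum_mul, h3]
    ring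
  simp_rw [h1, Finset.sum_add_distrib, ← Finset.mul_sum]
  simp

theorem gaussSum_complexQuadraticChar_sq (h2 : ringChar F ≠ 2) :
    gaussSum (complexQuadraticChar F) (traceChar F p) ^ 2 =
      quadraticChar F (-1) * Fintype.card F :=
  gaussSum_sq (complexQuadraticChar_ne_one h2) ((quadraticChar_isQuadratic F).comp _)
    traceChar_isPrimitive

theorem odd_of_ne_two (hp : p ≠ 2) : Odd p := (Fact.out : p.Prime).odd_of_ne_two hp

theorem ringChar_ne_two (hp : p ≠ 2) (F : Type*) [Field F] [Algebra (ZMod p) F] :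
    ringChar F ≠ 2 := by
  have : CharP F p := charP_of_injective_algebraMap (algebraMap (ZMod p) F).injective p
  rwa [ringChar.eq F p]

theorem pow_div_two (hp : p ≠ 2) (m : ℕ) :
    p ^ m / 2 = p / 2 * ∑ i ∈ Finset.range m, p ^ i := by
  obtain ⟨r, hr⟩ := odd_of_ne_two hp
  have h1 := geom_sum_mul_add (p - 1) m (R := ℕ)
  have h3 : p - 1 + 1 = p := by omega
  rw [h3] at h1
  have h4 : p - 1 = 2 * (p / 2) := by omega
  rw [h4] at h1
  have h5 : (∑ i ∈ Finset.range m, p ^ i) * (2 * (p / 2)) =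
    2 * (p / 2 * ∑ i ∈ Finset.range m, p ^ i) := by ring
  omega

/-- Euler's criterion: `(p^m - 1)/2` is `(p - 1)/2` times `1 + p + ... + p^(m-1)`, and this sum of
`m` odd terms has the parity of `m`. -/
theorem quadraticChar_algebraMap (hp : p ≠ 2) {m : ℕ} (hF : Fintype.card F = p ^ m)
    (y : ZMod p) :
    restrictChar (ZMod p) (quadraticChar F) y = quadraticChar (ZMod p) y ^ m := by
  have hm : m ≠ 0 := by
    rintro rfl
    exact (Fintype.one_lt_card (α := F)).ne' (by simpa using hF)
  rw [restrictChar_apply]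
  by_cases hy : y = 0
  · subst hy
    simp [hm]
  have hy' : algebraMap (ZMod p) F y ≠ 0 := by simpa using hy
  have hpow : (∑ i ∈ Finset.range m, p ^ i) % 2 = m % 2 := by
    have hpi : ∀ i, p ^ i % 2 = 1 := fun i => Nat.odd_iff.mp ((odd_of_ne_two hp).pow)
    rw [Finset.sum_nat_mod, Finset.sum_congr rfl fun i _ => hpi i]
    simp
  have h1 := quadraticChar_eq_pow_of_char_ne_two' (ringChar_ne_two hp F)
    (algebraMap (ZMod p) F y)
  have h3 := quadraticChar_eq_pow_of_char_ne_two' (ringChar_ne_two hp (ZMod p)) y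
  rw [ZMod.card] at h3
  rw [hF, pow_div_two hp m, pow_mul, ← map_pow (algebraMap (ZMod p) F), ← h3] at h1
  have hz := quadraticChar_dichotomy hy
  have hz' := quadraticChar_dichotomy hy'
  have hne : (1 : F) ≠ -1 := fun h => Ring.neg_one_ne_one_of_char_ne_two (ringChar_ne_two hp F) h.symm
  have h5 : quadraticChar (ZMod p) y ^ (∑ i ∈ Finset.range m, p ^ i) =
      quadraticChar (ZMod p) y ^ m := by
    rcases hz with h | h <;> rw [h]
    · simp
    · rw [neg_one_pow_eq_pow_mod_two, hpow, ← neg_one_pow_eq_pow_mod_two]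
  rw [map_intCast, ← Int.cast_pow, h5] at h1
  have hz5 : quadraticChar (ZMod p) y ^ m = 1 ∨ quadraticChar (ZMod p) y ^ m = -1 := by
    rcases hz with h | h <;> rw [h]
    · simp
    · exact neg_one_pow_eq_or ℤ m
  rcases hz' with h | h <;> rcases hz5 with h' | h' <;> rw [h, h'] at h1 ⊢ <;> simp at h1
  · exact (hne h1).elim
  · exact (hne h1.symm).elim

/-- The character is trivial on nonzero elements of `GF(p)`, so the sum over `y` is `p - 1` or `-1`,
and the Gauss sum squares to `#F`. The sign `s` is uniform in `a` and `τ`. -/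
theorem card_zeros_square_of_even (hp : p ≠ 2) {k : ℕ}
    (hF : Fintype.card F = p ^ (2 * (k + 1))) :
    ∃ s : ℤ, (s = 1 ∨ s = -1) ∧ ∀ a : F, a ≠ 0 → ∀ τ : ZMod p,
      ((Finset.univ.filter fun x : F => Algebra.trace (ZMod p) F (a * x ^ 2) + τ = 0).card : ℤ) =
        p ^ (2 * k + 1) + quadraticChar F a * s * p ^ k * (if τ = 0 then (p : ℤ) - 1 else -1) := by
  have h2 := ringChar_ne_two hp F
  have hχ : ∀ y : ZMod p, y ≠ 0 → restrictChar (ZMod p) (quadraticChar F) y = 1 := by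
    intro y hy
    rw [quadraticChar_algebraMap hp hF, pow_mul, quadraticChar_sq_one hy, one_pow]
  have hsum : ∀ τ : ZMod p,
      ∑ y : ZMod p, (restrictChar (ZMod p) (quadraticChar F) y : ℂ) * ZMod.stdAddChar (y * τ) =
        if τ = 0 then (p : ℂ) - 1 else -1 := by
    intro τ
    have h1 := sum_mulShift τ (ZMod.isPrimitive_stdAddChar p)
    rw [← Finset.add_sum_erase _ _ (Finset.mem_univ 0), zero_mul, map_zero_eq_one] at h1
    rw [← Finset.add_sum_erase _ _ (Finset.mem_univ 0), MulChar.map_zero, Int.cast_zero, zero_mul,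
      zero_add, Finset.sum_congr rfl fun y hy => by
        rw [hχ y (Finset.ne_of_mem_erase hy), Int.cast_one, one_mul],
      eq_sub_of_add_eq' h1, ZMod.card]
    split_ifs <;> simp
  have hG := gaussSum_complexQuadraticChar_sq (F := F) (p := p) h2
  have hm1 : quadraticChar F (-1) = 1 := by
    have := hχ (-1) (by simp)
    rwa [restrictChar_apply, map_neg, map_one] at this
  rw [hm1, hF, Int.cast_one, one_mul] at hG
  have hG' : ∃ s : ℤ, (s = 1 ∨ s = -1) ∧
      gaussSum (complexQuadraticChar F) (traceChar F p) = s * p ^ (k + 1) := by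
    push_cast at hG
    rw [mul_comm 2, pow_mul, sq_eq_sq_iff_eq_or_eq_neg] at hG
    rcases hG with h | h
    · exact ⟨1, Or.inl rfl, by rw [h]; simp⟩
    · exact ⟨-1, Or.inr rfl, by rw [h]; simp⟩
  obtain ⟨s, hs, hGs⟩ := hG'
  refine ⟨s, hs, fun a ha τ => ?_⟩
  have h3 := card_mul_card_zeros_square h2 ha τ
  rw [hsum, hGs, hF] at h3
  have hp0 : (p : ℤ) ≠ 0 := by exact_mod_cast (Fact.out : p.Prime).ne_zero
  apply mul_left_cancel₀ hp0
  have h4 : (p : ℤ) * ((Finset.univ.filter fun x : F =>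
      Algebra.trace (ZMod p) F (a * x ^ 2) + τ = 0).card : ℤ) = (p ^ (2 * (k + 1)) : ℕ) +
      quadraticChar F a * (s * p ^ (k + 1)) * (if τ = 0 then (p : ℤ) - 1 else -1) := by
    have h5 : (if τ = 0 then (p : ℂ) - 1 else -1) =
      ((if τ = 0 then (p : ℤ) - 1 else -1 : ℤ) : ℂ) := by split_ifs <;> simp
    rw [h5] at h3
    exact_mod_cast h3
  rw [h4]
  push_cast
  ring

/-- Here the sum over `y` is itself a Gauss sum over `GF(p)`. Both Gauss sums have squares with the
same factor `η(-1)`, so their product squares to `p^(2k+2)` and is rational. -/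
theorem card_zeros_square_of_odd (hp : p ≠ 2) {k : ℕ}
    (hF : Fintype.card F = p ^ (2 * k + 1)) :
    ∃ s : ℤ, (s = 1 ∨ s = -1) ∧ ∀ a : F, a ≠ 0 → ∀ τ : ZMod p,
      ((Finset.univ.filter fun x : F => Algebra.trace (ZMod p) F (a * x ^ 2) + τ = 0).card : ℤ) =
        p ^ (2 * k) + quadraticChar F a * s * p ^ k * quadraticChar (ZMod p) τ := by
  have h2 := ringChar_ne_two hp F
  have hχ : ∀ y : ZMod p, restrictChar (ZMod p) (quadraticChar F) y = quadraticChar (ZMod p) y := by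
    intro y
    rw [quadraticChar_algebraMap hp hF, pow_succ, pow_mul]
    by_cases hy : y = 0
    · subst hy
      simp
    · rw [quadraticChar_sq_one hy, one_pow, one_mul]
  have hχp := complexQuadraticChar_ne_one (ringChar_ne_two hp (ZMod p))
  have hsum : ∀ τ : ZMod p,
      ∑ y : ZMod p, (restrictChar (ZMod p) (quadraticChar F) y : ℂ) * ZMod.stdAddChar (y * τ) =
        quadraticChar (ZMod p) τ * gaussSum (complexQuadraticChar (ZMod p)) ZMod.stdAddChar := by
    intro τ
    simp_rw [hχ]
    by_cases hτ : τ = 0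
    · subst hτ
      simpa [gaussSum] using gaussSum_one_right hχp
    · have h := gaussSum_mulShift_eq (complexQuadraticChar (ZMod p)) ZMod.stdAddChar
        (Units.mk0 τ hτ)
      rw [((quadraticChar_isQuadratic (ZMod p)).comp _).inv] at h
      simp_rw [mul_comm _ τ]
      exact h
  have hG := gaussSum_complexQuadraticChar_sq (F := F) (p := p) h2
  have hGp := gaussSum_sq hχp ((quadraticChar_isQuadratic (ZMod p)).comp _)
    (ZMod.isPrimitive_stdAddChar p)
  have hm1 : quadraticChar F (-1) = quadraticChar (ZMod p) (-1) := by
    have := hχ (-1)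
    rwa [restrictChar_apply, map_neg, map_one] at this
  rw [complexQuadraticChar_apply, ← hm1, ZMod.card] at hGp
  have hG' : ∃ s : ℤ, (s = 1 ∨ s = -1) ∧
      gaussSum (complexQuadraticChar F) (traceChar F p) *
        gaussSum (complexQuadraticChar (ZMod p)) ZMod.stdAddChar = s * p ^ (k + 1) := by
    have h1 : (quadraticChar F (-1) : ℂ) ^ 2 = 1 := by
      exact_mod_cast quadraticChar_sq_one (F := F) (a := -1) (by simp)
    have h3 : (gaussSum (complexQuadraticChar F) (traceChar F p) *
        gaussSum (complexQuadraticChar (ZMod p)) ZMod.stdAddChar) ^ 2 = ((p : ℂ) ^ (k + 1)) ^ 2 := by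
      rw [mul_pow, hG, hGp, hF]
      push_cast
      linear_combination (p : ℂ) ^ (2 * k + 1) * p * h1
    rw [sq_eq_sq_iff_eq_or_eq_neg] at h3
    rcases h3 with h | h
    · exact ⟨1, Or.inl rfl, by rw [h]; simp⟩
    · exact ⟨-1, Or.inr rfl, by rw [h]; simp⟩
  obtain ⟨s, hs, hGs⟩ := hG'
  refine ⟨s, hs, fun a ha τ => ?_⟩
  have h3 := card_mul_card_zeros_square h2 ha τ
  rw [hsum, hF, mul_assoc, mul_left_comm _ (quadraticChar (ZMod p) τ : ℂ), hGs] at h3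
  have hp0 : (p : ℤ) ≠ 0 := by exact_mod_cast (Fact.out : p.Prime).ne_zero
  apply mul_left_cancel₀ hp0
  have h4 : (p : ℤ) * ((Finset.univ.filter fun x : F =>
      Algebra.trace (ZMod p) F (a * x ^ 2) + τ = 0).card : ℤ) = (p ^ (2 * k + 1) : ℕ) +
      quadraticChar F a * (quadraticChar (ZMod p) τ * (s * p ^ (k + 1))) := by
    exact_mod_cast h3
  rw [h4]
  push_cast
  ring

end QuadraticSums

/-! ### Dimension, symmetry and weight enumerator of the quadratic trace code. -/

section QuadraticTraceCode

variable (F : Type*) [Field F] (p : ℕ) [Fact p.Prime] [Algebra (ZMod p) F]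

/-- The word `(Tr (a x² + b x) + τ)_{x ∈ F}`, as a linear function of `(a, b, τ)`. -/
noncomputable def quadraticWord : F × F × ZMod p →ₗ[ZMod p] F → ZMod p where
  toFun t := fun x => Algebra.trace (ZMod p) F (t.1 * x ^ 2 + t.2.1 * x) + t.2.2
  map_add' s t := by
    funext x
    simp only [Prod.fst_add, Prod.snd_add, Pi.add_apply, add_mul, map_add]
    ring
  map_smul' r t := by
    funext x
    simp only [Prod.smul_fst, Prod.smul_snd, smul_mul_assoc, ← smul_add, map_smul, Pi.smul_apply,
      RingHom.id_apply]

variable {F p}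

theorem quadraticWord_apply (a b : F) (τ : ZMod p) (x : F) :
    quadraticWord F p (a, b, τ) x = Algebra.trace (ZMod p) F (a * x ^ 2 + b * x) + τ := rfl

theorem mem_traceCode_sq {v : F → ZMod p} : v ∈ traceCode p (Polynomial.X ^ 2 : Polynomial F) ↔
    ∃ a b c : F, v = fun x => Algebra.trace (ZMod p) F (a * x ^ 2 + b * x + c) := by
  change (∃ a b c : F, v = fun x => Algebra.trace (ZMod p) F
    (a * (Polynomial.X ^ 2 : Polynomial F).eval x + b * x + c)) ↔ _
  simp only [Polynomial.eval_pow, Polynomial.eval_X]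

theorem range_quadraticWord [Finite F] :
    LinearMap.range (quadraticWord F p) = traceCode p (Polynomial.X ^ 2 : Polynomial F) := by
  ext v
  rw [mem_traceCode_sq]
  constructor
  · rintro ⟨⟨a, b, τ⟩, rfl⟩
    obtain ⟨c, rfl⟩ := Algebra.trace_surjective (ZMod p) F τ
    exact ⟨a, b, c, by funext x; rw [quadraticWord_apply, map_add _ _ c]⟩
  · rintro ⟨a, b, c, rfl⟩
    exact ⟨(a, b, Algebra.trace (ZMod p) F c), by
      funext x; rw [quadraticWord_apply, map_add _ _ c]⟩

theorem quadraticWord_injective [Finite F] (hp : p ≠ 2) :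
    Function.Injective (quadraticWord F p) := by
  rw [injective_iff_map_eq_zero]
  rintro ⟨a, b, τ⟩ h
  have h0 : ∀ x, Algebra.trace (ZMod p) F (a * x ^ 2 + b * x) + τ = 0 := fun x => congrFun h x
  have hτ : τ = 0 := by simpa using h0 0
  subst hτ
  simp only [add_zero] at h0
  have h2 : (2 : F) ≠ 0 := Ring.two_ne_zero (ringChar_ne_two hp F)
  have ha : a = 0 := by
    by_contra ha
    obtain ⟨y, hy⟩ := exists_trace_mul_ne_zero (p := p) (mul_ne_zero h2 ha)
    apply hy
    -- Polarization removes `b`; the trace of each of the three terms vanishes.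
    have e : 2 * a * y = (a * (y + 1) ^ 2 + b * (y + 1)) - (a * y ^ 2 + b * y) -
      (a * 1 ^ 2 + b * 1) := by ring
    rw [e, map_sub, map_sub, h0, h0, h0]
    simp
  subst ha
  have hb : b = 0 := by
    by_contra hb
    obtain ⟨y, hy⟩ := exists_trace_mul_ne_zero (p := p) hb
    exact hy (by simpa using h0 y)
  subst hb
  rfl

theorem finrank_traceCode_sq [Fintype F] (hp : p ≠ 2) {m : ℕ} (hF : Fintype.card F = p ^ m) :
    Module.finrank (ZMod p) (traceCode p (Polynomial.X ^ 2 : Polynomial F)) = 2 * m + 1 := by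
  have hm : Module.finrank (ZMod p) F = m := by
    have h := Module.card_eq_pow_finrank (K := ZMod p) (V := F)
    rw [hF, ZMod.card] at h
    exact (Nat.pow_right_injective (Fact.out : p.Prime).two_le h).symm
  rw [← range_quadraticWord, LinearMap.finrank_range_of_inj (quadraticWord_injective hp),
    Module.finrank_prod, Module.finrank_prod, hm, Module.finrank_self]
  ring

theorem isDoublyTransitive_traceCode_sq [Fintype F] :
    IsDoublyTransitive (traceCode p (Polynomial.X ^ 2 : Polynomial F)) := by
  intro i j k l hij hkl
  have hji : j - i ≠ 0 := sub_ne_zero.mpr hij.symm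
  have hα : (l - k) / (j - i) ≠ 0 := div_ne_zero (sub_ne_zero.mpr hkl.symm) hji
  -- The affine map through `i ↦ k` and `j ↦ l`.
  refine ⟨((Equiv.subRight i).trans (Equiv.mulLeft₀ _ hα)).trans (Equiv.addRight k), ?_, ?_, ?_⟩
  · simp
  · simp [div_mul_cancel₀ _ hji]
  · intro v hv
    rw [mem_traceCode_sq] at hv ⊢
    obtain ⟨a, b, c, rfl⟩ := hv
    set α := (l - k) / (j - i)
    set β := k - α * i with hβ
    refine ⟨a * α ^ 2, 2 * a * α * β + b * α, a * β ^ 2 + b * β + c, ?_⟩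
    funext x
    simp only [Function.comp_apply, Equiv.trans_apply, Equiv.subRight_apply, Equiv.mulLeft₀_apply,
      Equiv.coe_addRight]
    congr 1
    rw [hβ]
    ring

theorem exists_mem_traceCode_sq_ne_zero [Finite F] (s : F) :
    ∃ v ∈ traceCode p (Polynomial.X ^ 2 : Polynomial F), v s ≠ 0 := by
  obtain ⟨c, hc⟩ := Algebra.trace_surjective (ZMod p) F 1
  refine ⟨_, mem_traceCode_sq.mpr ⟨0, 0, c, rfl⟩, ?_⟩
  simp [hc]

theorem exists_mem_vanishingSubcode_traceCode_sq_ne_zero [Finite F] {s t : F} (h : s ≠ t) :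
    ∃ v ∈ vanishingSubcode (traceCode p (Polynomial.X ^ 2 : Polynomial F)) {s}, v t ≠ 0 := by
  obtain ⟨b, hb⟩ := exists_trace_mul_ne_zero (p := p) (sub_ne_zero.mpr h.symm)
  refine ⟨fun x => Algebra.trace (ZMod p) F (0 * x ^ 2 + b * x + -(b * s)),
    ⟨mem_traceCode_sq.mpr ⟨0, b, _, rfl⟩, ?_⟩, ?_⟩
  · intro i hi
    rw [Finset.mem_singleton.mp hi]
    simp
  · have e : 0 * t ^ 2 + b * t + -(b * s) = (t - s) * b := by ring
    simpa only [e] using hb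

variable [Fintype F]

theorem weightCount_traceCode_sq (hp : p ≠ 2) (w : ℕ) :
    (weightCount (traceCode p (Polynomial.X ^ 2 : Polynomial F)) w : ℚ) =
      ∑ a : F, ∑ b : F, ∑ τ : ZMod p,
        if (hammingNorm (quadraticWord F p (a, b, τ)) : ℤ) = w then 1 else 0 := by
  classical
  have h : {v | v ∈ traceCode p (Polynomial.X ^ 2 : Polynomial F) ∧ hammingNorm v = w} =
      quadraticWord F p '' {t | hammingNorm (quadraticWord F p t) = w} := by
    ext v
    rw [← range_quadraticWord]
    constructor
    · rintro ⟨⟨t, rfl⟩, hw⟩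
      exact ⟨t, hw, rfl⟩
    · rintro ⟨t, hw, rfl⟩
      exact ⟨⟨t, rfl⟩, hw⟩
  unfold weightCount
  rw [h, Set.ncard_image_of_injective _ (quadraticWord_injective hp), Set.ncard_eq_toFinset_card',
    Set.toFinset_ofPred, Finset.card_filter]
  push_cast
  simp_rw [Fintype.sum_prod_type, Nat.cast_inj]

theorem hammingNorm_quadraticWord_eq_sub (a b : F) (τ : ZMod p) :
    (hammingNorm (quadraticWord F p (a, b, τ)) : ℤ) = Fintype.card F -
      (Finset.univ.filter fun x : F =>
        Algebra.trace (ZMod p) F (a * x ^ 2 + b * x) + τ = 0).card := by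
  rw [← card_zeros_add_hammingNorm (quadraticWord F p (a, b, τ))]
  push_cast
  exact (add_sub_cancel_left _ _).symm

/-- Completing the square is a translation of the coordinates, which preserves the weight. -/
theorem hammingNorm_quadraticWord_complete_square (hp : p ≠ 2) {a : F} (ha : a ≠ 0) (b : F)
    (τ : ZMod p) : hammingNorm (quadraticWord F p (a, b, τ)) =
      hammingNorm (quadraticWord F p (a, 0, τ - Algebra.trace (ZMod p) F (b ^ 2 / (4 * a)))) := by
  rw [← hammingNorm_comp_perm (Equiv.addRight (b / (2 * a)))
    (quadraticWord F p (a, 0, τ - Algebra.trace (ZMod p) F (b ^ 2 / (4 * a))))]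
  congr 1
  funext x
  have h2 : (2 : F) ≠ 0 := Ring.two_ne_zero (ringChar_ne_two hp F)
  have e : a * x ^ 2 + b * x = a * (x + b / (2 * a)) ^ 2 + 0 * (x + b / (2 * a)) -
      b ^ 2 / (4 * a) := by
    have h4 : (4 : F) = 2 * 2 := by norm_num
    rw [h4]
    field_simp
    ring
  rw [Function.comp_apply, quadraticWord_apply, quadraticWord_apply, Equiv.coe_addRight, e, map_sub]
  ring

theorem hammingNorm_quadraticWord_linear {b : F} (hb : b ≠ 0) (τ : ZMod p) {m : ℕ}
    (hF : Fintype.card F = p ^ (m + 1)) :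
    (hammingNorm (quadraticWord F p (0, b, τ)) : ℤ) = p ^ m * (p - 1) := by
  classical
  have h := card_mul_card_zeros fun x => Algebra.trace (ZMod p) F (0 * x ^ 2 + b * x) + τ
  have h1 : ∀ y : ZMod p, ∑ x : F,
      ZMod.stdAddChar (y * (Algebra.trace (ZMod p) F (0 * x ^ 2 + b * x) + τ)) =
        if y = 0 then (Fintype.card F : ℂ) else 0 := by
    intro y
    split_ifs with hy
    · simp [hy]
    have hyb : algebraMap (ZMod p) F y * b ≠ 0 := mul_ne_zero (by simpa using hy) hb
    have h3 := AddChar.sum_mulShift (algebraMap (ZMod p) F y * b)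
      (traceChar_isPrimitive (F := F) (p := p))
    rw [if_neg hyb, Nat.cast_zero] at h3
    rw [← zero_mul (ZMod.stdAddChar (y * τ)), ← h3, Finset.sum_mul]
    refine Finset.sum_congr rfl fun x _ => ?_
    rw [traceChar_apply, mul_comm x, mul_assoc, ← Algebra.smul_def, map_smul, smul_eq_mul,
      mul_add, AddChar.map_add_eq_mul, zero_mul, zero_add]
  simp_rw [h1, Finset.sum_ite_eq' Finset.univ, if_pos (Finset.mem_univ _)] at h
  have h4 : p * (Finset.univ.filter fun x : F =>
      Algebra.trace (ZMod p) F (0 * x ^ 2 + b * x) + τ = 0).card = p * p ^ m := by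
    rw [← pow_succ', ← hF]
    exact_mod_cast h
  rw [hammingNorm_quadraticWord_eq_sub, Nat.eq_of_mul_eq_mul_left (Fact.out : p.Prime).pos h4, hF]
  push_cast
  ring

theorem hammingNorm_quadraticWord_const {τ : ZMod p} (hτ : τ ≠ 0) :
    hammingNorm (quadraticWord F p (0, 0, τ)) = Fintype.card F := by
  unfold hammingNorm
  rw [← Finset.card_univ]
  congr 1
  simp [quadraticWord_apply, hτ]

theorem sum_zmod_split (f : ZMod p → ℚ) (A B : ℚ) (h0 : f 0 = A) (h1 : ∀ τ, τ ≠ 0 → f τ = B) :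
    ∑ τ, f τ = A + (p - 1) * B := by
  rw [← Finset.add_sum_erase _ _ (Finset.mem_univ (0 : ZMod p)), h0,
    Finset.sum_congr rfl fun y hy => h1 y (Finset.ne_of_mem_erase hy), Finset.sum_const,
    Finset.card_erase_of_mem (Finset.mem_univ _), Finset.card_univ, ZMod.card, nsmul_eq_mul,
    Nat.cast_sub (Fact.out : p.Prime).one_le, Nat.cast_one]

/-- An arbitrary `g` treats all weights at once, including coinciding ones. For `a ≠ 0`, completing
the square only shifts `τ`, so every `b` contributes the same amount. -/
theorem sum_hammingNorm_quadraticWord [DecidableEq F] (hp : p ≠ 2) {m : ℕ}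
    (hF : Fintype.card F = p ^ (m + 1)) (g : ℤ → ℚ) :
    ∑ a : F, ∑ b : F, ∑ τ : ZMod p, g (hammingNorm (quadraticWord F p (a, b, τ))) =
      g 0 + (p - 1) * g (p ^ (m + 1)) + p * (p ^ (m + 1) - 1) * g (p ^ m * (p - 1)) +
      p ^ (m + 1) * ∑ τ : ZMod p, ∑ a ∈ Finset.univ.erase (0 : F),
        g (hammingNorm (quadraticWord F p (a, 0, τ))) := by
  have hcard : ((Finset.univ.erase (0 : F)).card : ℚ) = p ^ (m + 1) - 1 := by
    rw [Finset.card_erase_of_mem (Finset.mem_univ _), Finset.card_univ,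
      Nat.cast_sub Fintype.card_pos, hF]
    simp
  have h00 : quadraticWord F p (0, 0, 0) = 0 := map_zero _
  rw [← Finset.add_sum_erase _ _ (Finset.mem_univ (0 : F))]
  congr 1
  · rw [← Finset.add_sum_erase _ _ (Finset.mem_univ (0 : F))]
    congr 1
    · apply sum_zmod_split
      · rw [h00, hammingNorm_zero, Nat.cast_zero]
      · intro τ hτ
        rw [hammingNorm_quadraticWord_const hτ, hF, Nat.cast_pow]
    · rw [Finset.sum_congr rfl fun b hb => Finset.sum_congr rfl fun τ _ => by
        rw [hammingNorm_quadraticWord_linear (Finset.ne_of_mem_erase hb) τ hF]]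
      rw [Finset.sum_const, Finset.sum_const, nsmul_eq_mul, nsmul_eq_mul, hcard, Finset.card_univ,
        ZMod.card]
      ring
  · rw [Finset.sum_comm (s := (Finset.univ : Finset (ZMod p))), Finset.mul_sum]
    refine Finset.sum_congr rfl fun a ha => ?_
    have h1 : ∀ b : F, ∑ τ : ZMod p, g (hammingNorm (quadraticWord F p (a, b, τ))) =
        ∑ τ : ZMod p, g (hammingNorm (quadraticWord F p (a, 0, τ))) := by
      intro b
      simp_rw [hammingNorm_quadraticWord_complete_square hp (Finset.ne_of_mem_erase ha) b]
      exact Fintype.sum_equiv (Equiv.subRight _) _ _ fun τ => rfl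
    rw [Finset.sum_congr rfl fun b _ => h1 b, Finset.sum_const, Finset.card_univ, hF, nsmul_eq_mul,
      Nat.cast_pow]

/-- The quadratic character takes the values `1` and `-1` equally often. -/
theorem sum_comp_quadraticChar {F : Type*} [Field F] [Fintype F] [DecidableEq F]
    (h2 : ringChar F ≠ 2) {s : ℤ} (hs : s = 1 ∨ s = -1) (f : ℤ → ℚ) :
    ∑ a ∈ Finset.univ.erase (0 : F), f (quadraticChar F a * s) =
      (Fintype.card F - 1) / 2 * (f 1 + f (-1)) := by
  -- On `{1, -1}` every function is affine, and the linear part sums to zero.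
  have h1 : ∀ a ∈ Finset.univ.erase (0 : F), f (quadraticChar F a * s) =
      (f 1 + f (-1)) / 2 + quadraticChar F a * (s * ((f 1 - f (-1)) / 2)) := by
    intro a ha
    rcases quadraticChar_dichotomy (Finset.ne_of_mem_erase ha) with h | h <;>
      rcases hs with rfl | rfl <;> rw [h] <;> push_cast <;> norm_num <;> ring
  have h3 : ∑ a ∈ Finset.univ.erase (0 : F), (quadraticChar F a : ℚ) = 0 := by
    have h := quadraticChar_sum_zero h2
    rw [← Finset.add_sum_erase _ _ (Finset.mem_univ (0 : F)), MulChar.map_zero, zero_add] at h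
    exact_mod_cast h
  rw [Finset.sum_congr rfl h1, Finset.sum_add_distrib, ← Finset.sum_mul, h3, Finset.sum_const,
    Finset.card_erase_of_mem (Finset.mem_univ _), Finset.card_univ, nsmul_eq_mul,
    Nat.cast_sub Fintype.card_pos]
  push_cast
  ring

theorem sum_hammingNorm_quadraticWord_even (hp : p ≠ 2) {k : ℕ}
    (hF : Fintype.card F = p ^ (2 * (k + 1))) (g : ℤ → ℚ) :
    ∑ a : F, ∑ b : F, ∑ τ : ZMod p, g (hammingNorm (quadraticWord F p (a, b, τ))) =
      g 0 + (p - 1) * g (p ^ (2 * k + 2)) +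
      p * (p ^ (2 * k + 2) - 1) * g (p ^ (2 * k + 1) * (p - 1)) +
      p ^ (2 * k + 2) * ((p ^ (2 * k + 2) - 1) / 2) *
        (g ((p - 1) * (p ^ (2 * k + 1) - p ^ k)) + g ((p - 1) * (p ^ (2 * k + 1) + p ^ k)) +
        (p - 1) * (g ((p - 1) * p ^ (2 * k + 1) - p ^ k) +
          g ((p - 1) * p ^ (2 * k + 1) + p ^ k))) := by
  classical
  have h2 := ringChar_ne_two hp F
  obtain ⟨s, hs, hz⟩ := card_zeros_square_of_even hp hF
  let f : ZMod p → ℤ → ℚ := fun τ e => g ((p - 1) * p ^ (2 * k + 1) -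
        e * p ^ k * (if τ = 0 then (p : ℤ) - 1 else -1))
  have hw : ∀ τ : ZMod p, ∀ a ∈ Finset.univ.erase (0 : F),
      g (hammingNorm (quadraticWord F p (a, 0, τ))) = f τ (quadraticChar F a * s) := by
    intro τ a ha
    have h := hz a (Finset.ne_of_mem_erase ha) τ
    rw [hammingNorm_quadraticWord_eq_sub]
    simp only [zero_mul, add_zero]
    rw [h, hF]
    apply congrArg g
    push_cast
    ring
  rw [sum_hammingNorm_quadraticWord hp (m := 2 * k + 1) hF,
    Finset.sum_congr rfl fun τ _ => (Finset.sum_congr rfl (hw τ)).trans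
      (sum_comp_quadraticChar h2 hs (f τ))]
  simp only [f]
  rw [sum_zmod_split _ _ _ rfl fun τ hτ => by rw [if_neg hτ], if_pos rfl, hF]
  have e1 : ((p : ℤ) - 1) * p ^ (2 * k + 1) - 1 * p ^ k * (p - 1) =
    (p - 1) * (p ^ (2 * k + 1) - p ^ k) := by ring
  have e2 : ((p : ℤ) - 1) * p ^ (2 * k + 1) - -1 * p ^ k * (p - 1) =
    (p - 1) * (p ^ (2 * k + 1) + p ^ k) := by ring
  have e3 : ((p : ℤ) - 1) * p ^ (2 * k + 1) - 1 * p ^ k * -1 =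
    (p - 1) * p ^ (2 * k + 1) + p ^ k := by ring
  have e4 : ((p : ℤ) - 1) * p ^ (2 * k + 1) - -1 * p ^ k * -1 =
    (p - 1) * p ^ (2 * k + 1) - p ^ k := by ring
  rw [e1, e2, e3, e4]
  push_cast
  ring

theorem sum_hammingNorm_quadraticWord_odd (hp : p ≠ 2) {k : ℕ}
    (hF : Fintype.card F = p ^ (2 * k + 1)) (g : ℤ → ℚ) :
    ∑ a : F, ∑ b : F, ∑ τ : ZMod p, g (hammingNorm (quadraticWord F p (a, b, τ))) =
      g 0 + (p - 1) * g (p ^ (2 * k + 1)) +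
      (p + p ^ (2 * k + 1)) * (p ^ (2 * k + 1) - 1) * g (p ^ (2 * k) * (p - 1)) +
      p ^ (2 * k + 1) * (p - 1) * ((p ^ (2 * k + 1) - 1) / 2) *
        (g (p ^ (2 * k) * (p - 1) - p ^ k) + g (p ^ (2 * k) * (p - 1) + p ^ k)) := by
  classical
  have h2 := ringChar_ne_two hp F
  obtain ⟨s, hs, hz⟩ := card_zeros_square_of_odd hp hF
  let f : ZMod p → ℤ → ℚ := fun τ e => g (p ^ (2 * k) * (p - 1) -
        e * p ^ k * quadraticChar (ZMod p) τ)
  have hw : ∀ τ : ZMod p, ∀ a ∈ Finset.univ.erase (0 : F),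
      g (hammingNorm (quadraticWord F p (a, 0, τ))) = f τ (quadraticChar F a * s) := by
    intro τ a ha
    have h := hz a (Finset.ne_of_mem_erase ha) τ
    rw [hammingNorm_quadraticWord_eq_sub]
    simp only [zero_mul, add_zero]
    rw [h, hF]
    apply congrArg g
    push_cast
    ring
  rw [sum_hammingNorm_quadraticWord hp (m := 2 * k) hF,
    Finset.sum_congr rfl fun τ _ => (Finset.sum_congr rfl (hw τ)).trans
      (sum_comp_quadraticChar h2 hs (f τ))]
  simp only [f]
  rw [sum_zmod_split _ ((Fintype.card F - 1) * g (p ^ (2 * k) * (p - 1)))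
    ((Fintype.card F - 1) / 2 *
      (g (p ^ (2 * k) * (p - 1) - p ^ k) + g (p ^ (2 * k) * (p - 1) + p ^ k))) ?_ ?_, hF]
  · push_cast
    ring
  · rw [MulChar.map_zero, mul_zero, mul_zero, sub_zero]
    ring
  -- The sign of `τ` only exchanges the two outer weights.
  · intro τ hτ
    rcases quadraticChar_dichotomy hτ with h | h <;> rw [h]
    · congr 3 <;> ring
    · rw [add_comm]
      congr 3 <;> ring

end QuadraticTraceCode

/-! ### From the weight enumerator to the tables of the shortened codes. -/

section WeightTables

/-- Indicator sums add up rows of equal weight. For `m = 1` the largest quadratic weight is `p`, the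
weight of the nonzero constants. -/
theorem sum_filter_weight (table : List (ℤ × ℚ)) (w : ℤ) :
    ((table.filter fun r => r.1 = w).map Prod.snd).sum =
      (table.map fun r => r.2 * if r.1 = w then 1 else 0).sum := by
  induction table with
  | nil => rfl
  | cons r l ih =>
    by_cases h : r.1 = w
    · simp [h, ih]
    · simp [h, ih]

/-- If the weight enumerator of `D` is that of `C` multiplied by a function `f` of the weight, then
the table of `D` is obtained from that of `C` row by row; a row of multiplicity `0` may be dropped. -/
theorem HasWeightDistribution.of_scaled {K ι κ : Type*} [Field K] [DecidableEq K] [Fintype ι]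
    [Fintype κ] {C : Submodule K (ι → K)} {D : Submodule K (κ → K)} {l t : List (ℤ × ℚ)}
    (hC : HasWeightDistribution C l) {f : ℤ → ℚ}
    (hf : ∀ w : ℕ, (weightCount D w : ℚ) = f w * weightCount C w) {x : ℤ}
    (h : List.Forall₂ (fun r s => r.1 = s.1 ∧ f s.1 * r.2 = s.2) l ((x, 0) :: t)) :
    HasWeightDistribution D t := by
  intro w
  have key : ∀ {l l' : List (ℤ × ℚ)},
      List.Forall₂ (fun r s => r.1 = s.1 ∧ f s.1 * r.2 = s.2) l l' →
      f w * (l.map fun r => r.2 * if r.1 = (w : ℤ) then 1 else 0).sum =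
        (l'.map fun r => r.2 * if r.1 = (w : ℤ) then 1 else 0).sum := by
    intro l l' h
    induction h with
    | nil => simp
    | @cons r s l l' hr _ ih =>
      rw [List.map_cons, List.map_cons, List.sum_cons, List.sum_cons, mul_add, ih, hr.1]
      split_ifs with hw
      · rw [← hw, mul_one, hr.2, mul_one]
      · rw [mul_zero, mul_zero, mul_zero]
  rw [hf, hC w, sum_filter_weight, sum_filter_weight, key h]
  simp

theorem pow_sub_one_ne_zero (F : Type*) [Fintype F] [Nontrivial F] {p m : ℕ}
    (hF : Fintype.card F = p ^ m) : (p : ℚ) ^ m - 1 ≠ 0 := by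
  have := Fintype.one_lt_card (α := F)
  rw [hF] at this
  exact sub_ne_zero.mpr (by exact_mod_cast this.ne')

variable {F : Type*} [Field F] [Fintype F] {p : ℕ} [Fact p.Prime] [Algebra (ZMod p) F]

theorem hasWeightDistribution_traceCode_sq_even (hp : p ≠ 2) {k : ℕ}
    (hF : Fintype.card F = p ^ (2 * (k + 1))) :
    HasWeightDistribution (traceCode p (Polynomial.X ^ 2 : Polynomial F))
      [((p : ℤ) ^ (2 * (k + 1)), (p : ℚ) - 1), (0, 1),
        (((p : ℤ) - 1) * ((p : ℤ) ^ (2 * k + 1) - (p : ℤ) ^ k),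
          (p : ℚ) ^ (2 * k + 2) * (((p : ℚ) ^ (2 * k + 2) - 1) / 2)),
        (((p : ℤ) - 1) * (p : ℤ) ^ (2 * k + 1) - (p : ℤ) ^ k,
          (p : ℚ) ^ (2 * k + 2) * (((p : ℚ) ^ (2 * k + 2) - 1) / 2) * (p - 1)),
        (((p : ℤ) - 1) * (p : ℤ) ^ (2 * k + 1), (p : ℚ) * ((p : ℚ) ^ (2 * k + 2) - 1)),
        (((p : ℤ) - 1) * (p : ℤ) ^ (2 * k + 1) + (p : ℤ) ^ k,
          (p : ℚ) ^ (2 * k + 2) * (((p : ℚ) ^ (2 * k + 2) - 1) / 2) * (p - 1)),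
        (((p : ℤ) - 1) * ((p : ℤ) ^ (2 * k + 1) + (p : ℤ) ^ k),
          (p : ℚ) ^ (2 * k + 2) * (((p : ℚ) ^ (2 * k + 2) - 1) / 2))] := by
  intro w
  rw [weightCount_traceCode_sq hp,
    sum_hammingNorm_quadraticWord_even hp hF fun x => if x = (w : ℤ) then 1 else 0,
    sum_filter_weight]
  simp only [List.map_cons, List.map_nil, List.sum_cons, List.sum_nil,
    mul_comm ((p : ℤ) ^ (2 * k + 1)) ((p : ℤ) - 1), show 2 * (k + 1) = 2 * k + 2 by ring]
  ring

theorem hasWeightDistribution_traceCode_sq_odd (hp : p ≠ 2) {k : ℕ}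
    (hF : Fintype.card F = p ^ (2 * k + 1)) :
    HasWeightDistribution (traceCode p (Polynomial.X ^ 2 : Polynomial F))
      [((p : ℤ) ^ (2 * k + 1), (p : ℚ) - 1), (0, 1),
        ((p : ℤ) ^ (2 * k) * (p - 1),
          ((p : ℚ) + (p : ℚ) ^ (2 * k + 1)) * ((p : ℚ) ^ (2 * k + 1) - 1)),
        ((p : ℤ) ^ (2 * k) * (p - 1) - (p : ℤ) ^ k,
          (p : ℚ) ^ (2 * k + 1) * (p - 1) * (((p : ℚ) ^ (2 * k + 1) - 1) / 2)),
        ((p : ℤ) ^ (2 * k) * (p - 1) + (p : ℤ) ^ k,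
          (p : ℚ) ^ (2 * k + 1) * (p - 1) * (((p : ℚ) ^ (2 * k + 1) - 1) / 2))] := by
  intro w
  rw [weightCount_traceCode_sq hp,
    sum_hammingNorm_quadraticWord_odd hp hF fun x => if x = (w : ℤ) then 1 else 0,
    sum_filter_weight]
  simp only [List.map_cons, List.map_nil, List.sum_cons, List.sum_nil]
  ring

theorem weightCount_shorten_singleton_eq [DecidableEq F] {m : ℕ} (hF : Fintype.card F = p ^ m)
    (s : F) (w : ℕ) :
    (weightCount (shorten (traceCode p (Polynomial.X ^ 2 : Polynomial F)) {s}) w : ℚ) =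
      ((p ^ m - (w : ℤ)) / p ^ m : ℚ) *
        weightCount (traceCode p (Polynomial.X ^ 2 : Polynomial F)) w := by
  have h := (isDoublyTransitive_traceCode_sq (F := F)
    (p := p)).card_mul_weightCount_shorten_singleton s w
  have hp0 : (p : ℚ) ^ m ≠ 0 := pow_ne_zero _ (by exact_mod_cast (Fact.out : p.Prime).ne_zero)
  rw [hF] at h
  push_cast at h ⊢
  rw [div_mul_eq_mul_div, eq_div_iff hp0, ← h, mul_comm]

theorem weightCount_shorten_pair_eq [DecidableEq F] {m : ℕ} (hF : Fintype.card F = p ^ m)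
    {s t : F} (hst : s ≠ t) (w : ℕ) :
    (weightCount (shorten (traceCode p (Polynomial.X ^ 2 : Polynomial F)) {s, t}) w : ℚ) =
      ((p ^ m - (w : ℤ)) * (p ^ m - (w : ℤ) - 1) / (p ^ m * (p ^ m - 1)) : ℚ) *
        weightCount (traceCode p (Polynomial.X ^ 2 : Polynomial F)) w := by
  have h := (isDoublyTransitive_traceCode_sq (F := F)
    (p := p)).card_mul_weightCount_shorten_pair hst w
  have hp0 : (p : ℚ) ^ m ≠ 0 := pow_ne_zero _ (by exact_mod_cast (Fact.out : p.Prime).ne_zero)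
  have hp1 := pow_sub_one_ne_zero F hF
  rw [hF] at h
  push_cast at h ⊢
  rw [eq_comm, div_mul_eq_mul_div, div_eq_iff (mul_ne_zero hp0 hp1), ← h]
  ring

theorem hasWeightDistribution_oddOne [DecidableEq F] (hp : p ≠ 2) {k : ℕ}
    (hF : Fintype.card F = p ^ (2 * k + 1)) (s : F) :
    HasWeightDistribution (shorten (traceCode p (Polynomial.X ^ 2 : Polynomial F)) {s})
      (tableOddOne p (2 * k + 1)) := by
  have hp0 : (p : ℚ) ≠ 0 := by exact_mod_cast (Fact.out : p.Prime).ne_zero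
  have hq1 := pow_sub_one_ne_zero F hF
  -- For `k = 0` this exponent is `-1`, so it has to stay an integer.
  have e1 : (((2 * k + 1 : ℕ) : ℤ) - 3) / 2 = (k : ℤ) - 1 := by omega
  have e2 : (1 + (2 * k + 1)) / 2 = k + 1 := by omega
  have e3 : 2 * k / 2 = k := by omega
  refine (hasWeightDistribution_traceCode_sq_odd hp hF).of_scaled
    (f := fun w => ((p : ℚ) ^ (2 * k + 1) - (w : ℤ)) / (p : ℚ) ^ (2 * k + 1))
    -- The dropped row is that of the nonzero constants: the factor `f` vanishes at full weight.
    (x := (p : ℤ) ^ (2 * k + 1)) (weightCount_shorten_singleton_eq hF s) ?_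
  simp only [tableOddOne, e1, e2, e3, Nat.add_sub_cancel,
    List.forall₂_cons, List.forall₂_nil_left_iff, and_true, true_and, zpow_sub₀ hp0, zpow_natCast,
    zpow_one]
  refine ⟨?_, ?_, ?_, ?_, ?_⟩
  all_goals
    push_cast
    field_simp
    ring

theorem hasWeightDistribution_oddTwo [DecidableEq F] (hp : p ≠ 2) {k : ℕ}
    (hF : Fintype.card F = p ^ (2 * k + 1)) {s t : F}
    (hst : s ≠ t) :
    HasWeightDistribution (shorten (traceCode p (Polynomial.X ^ 2 : Polynomial F)) {s, t})
      (tableOddTwo p (2 * k + 1)) := by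
  have hp0 : (p : ℚ) ≠ 0 := by exact_mod_cast (Fact.out : p.Prime).ne_zero
  have hq1 := pow_sub_one_ne_zero F hF
  have e1 : 2 * (2 * k + 1) - 2 = 4 * k := by omega
  have e2 : (3 * (2 * k + 1) - 3) / 2 = 3 * k := by omega
  have e3 : 2 * k / 2 = k := by omega
  refine (hasWeightDistribution_traceCode_sq_odd hp hF).of_scaled
    (f := fun w => ((p : ℚ) ^ (2 * k + 1) - (w : ℤ)) * ((p : ℚ) ^ (2 * k + 1) - (w : ℤ) - 1) /
      ((p : ℚ) ^ (2 * k + 1) * ((p : ℚ) ^ (2 * k + 1) - 1)))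
    (x := (p : ℤ) ^ (2 * k + 1)) (weightCount_shorten_pair_eq hF hst) ?_
  simp only [tableOddTwo, e1, e2, e3, Nat.add_sub_cancel,
    List.forall₂_cons, List.forall₂_nil_left_iff, and_true, true_and]
  refine ⟨?_, ?_, ?_, ?_, ?_⟩
  all_goals
    push_cast
    field_simp
    ring

theorem hasWeightDistribution_evenOne [DecidableEq F] (hp : p ≠ 2) {k : ℕ}
    (hF : Fintype.card F = p ^ (2 * (k + 1))) (s : F) :
    HasWeightDistribution (shorten (traceCode p (Polynomial.X ^ 2 : Polynomial F)) {s})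
      (tableEvenOne p (2 * (k + 1))) := by
  have hp0 : (p : ℚ) ≠ 0 := by exact_mod_cast (Fact.out : p.Prime).ne_zero
  have hq1 := pow_sub_one_ne_zero F hF
  have e1 : 2 * (k + 1) - 1 = 2 * k + 1 := by omega
  have e2 : (2 * (k + 1) - 2) / 2 = k := by omega
  have e3 : 2 * (k + 1) / 2 = k + 1 := by omega
  refine (hasWeightDistribution_traceCode_sq_even hp hF).of_scaled
    (f := fun w => ((p : ℚ) ^ (2 * (k + 1)) - (w : ℤ)) / (p : ℚ) ^ (2 * (k + 1)))
    (x := (p : ℤ) ^ (2 * (k + 1))) (weightCount_shorten_singleton_eq hF s) ?_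
  simp only [tableEvenOne, e1, e2, e3, Nat.add_sub_cancel,
    List.forall₂_cons, List.forall₂_nil_left_iff, and_true, true_and]
  refine ⟨?_, ?_, ?_, ?_, ?_, ?_, ?_⟩
  all_goals
    push_cast
    field_simp
    ring

theorem hasWeightDistribution_evenTwo [DecidableEq F] (hp : p ≠ 2) {k : ℕ}
    (hF : Fintype.card F = p ^ (2 * (k + 1))) {s t : F}
    (hst : s ≠ t) :
    HasWeightDistribution (shorten (traceCode p (Polynomial.X ^ 2 : Polynomial F)) {s, t})
      (tableEvenTwo p (2 * (k + 1))) := by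
  have hp0 : (p : ℚ) ≠ 0 := by exact_mod_cast (Fact.out : p.Prime).ne_zero
  have hq1 := pow_sub_one_ne_zero F hF
  have e1 : 2 * (k + 1) - 1 = 2 * k + 1 := by omega
  have e2 : (2 * (k + 1) - 2) / 2 = k := by omega
  have e3 : 2 * (k + 1) / 2 = k + 1 := by omega
  have e4 : ((2 * (k + 1) : ℕ) : ℤ) / 2 - 2 = (k : ℤ) - 1 := by omega
  refine (hasWeightDistribution_traceCode_sq_even hp hF).of_scaled
    (f := fun w => ((p : ℚ) ^ (2 * (k + 1)) - (w : ℤ)) * ((p : ℚ) ^ (2 * (k + 1)) - (w : ℤ) - 1) /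
      ((p : ℚ) ^ (2 * (k + 1)) * ((p : ℚ) ^ (2 * (k + 1)) - 1)))
    (x := (p : ℤ) ^ (2 * (k + 1))) (weightCount_shorten_pair_eq hF hst) ?_
  simp only [tableEvenTwo, e1, e2, e3, e4,
    List.forall₂_cons, List.forall₂_nil_left_iff, and_true, true_and, zpow_sub₀ hp0, zpow_natCast,
    zpow_one]
  refine ⟨?_, ?_, ?_, ?_, ?_, ?_, ?_⟩
  all_goals
    push_cast
    field_simp
    ring

theorem finrank_shorten_singleton (hp : p ≠ 2) {m : ℕ} (hF : Fintype.card F = p ^ m) (s : F) :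
    Module.finrank (ZMod p) (shorten (traceCode p (Polynomial.X ^ 2 : Polynomial F)) {s}) =
      2 * m := by
  have h := finrank_vanishingSubcode_singleton _ s (exists_mem_traceCode_sq_ne_zero (p := p) s)
  rw [finrank_traceCode_sq hp hF] at h
  rw [finrank_shorten]
  omega

theorem finrank_shorten_pair [DecidableEq F] (hp : p ≠ 2) {m : ℕ} (hF : Fintype.card F = p ^ m)
    {s t : F} (hst : s ≠ t) :
    Module.finrank (ZMod p) (shorten (traceCode p (Polynomial.X ^ 2 : Polynomial F)) {s, t}) =
      2 * m - 1 := by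
  have h := finrank_vanishingSubcode_singleton _ t
    (exists_mem_vanishingSubcode_traceCode_sq_ne_zero (p := p) hst)
  rw [← finrank_shorten _ {s}, finrank_shorten_singleton hp hF] at h
  rw [finrank_shorten, vanishingSubcode_pair]
  omega

theorem card_not_mem {ι : Type*} [Fintype ι] [DecidableEq ι] {n : ℕ} (hn : Fintype.card ι = n)
    (T : Finset ι) : Fintype.card {x : ι // x ∉ T} = n - T.card := by
  rw [Fintype.card_subtype_compl, hn, Fintype.card_coe]

end WeightTables

end CodeShortening

theorem mainTheorem10 (p : ℕ) [Fact p.Prime] (hp : p ≠ 2) (m : ℕ) (hm : 0 < m)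
    (F : Type*) [Field F] [Fintype F] [DecidableEq F] [Algebra (ZMod p) F]
    (hF : Fintype.card F = p ^ m) :
    let C : Submodule (ZMod p) (F → ZMod p) :=
      CodeShortening.traceCode p (Polynomial.X ^ 2 : Polynomial F)
    CodeShortening.IsLinearCode C (p ^ m) (2 * m + 1) ∧
    (∀ T : Finset F, T.card = 1 →
      CodeShortening.IsLinearCode (CodeShortening.shorten C T) (p ^ m - 1) (2 * m) ∧
      (Odd m → CodeShortening.HasWeightDistribution (CodeShortening.shorten C T)
        (CodeShortening.tableOddOne p m)) ∧
      (Even m → CodeShortening.HasWeightDistribution (CodeShortening.shorten C T)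
        (CodeShortening.tableEvenOne p m))) ∧
    (∀ T : Finset F, T.card = 2 →
      CodeShortening.IsLinearCode (CodeShortening.shorten C T) (p ^ m - 2) (2 * m - 1) ∧
      (Odd m → CodeShortening.HasWeightDistribution (CodeShortening.shorten C T)
        (CodeShortening.tableOddTwo p m)) ∧
      (Even m → CodeShortening.HasWeightDistribution (CodeShortening.shorten C T)
        (CodeShortening.tableEvenTwo p m))) := by
  intro C
  refine ⟨⟨hF, CodeShortening.finrank_traceCode_sq hp hF⟩, fun T hT => ?_, fun T hT => ?_⟩
  · obtain ⟨s, rfl⟩ := Finset.card_eq_one.mp hT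
    refine ⟨⟨by rw [CodeShortening.card_not_mem hF, hT],
      CodeShortening.finrank_shorten_singleton hp hF s⟩, ?_, ?_⟩
    · rintro ⟨k, rfl⟩
      exact CodeShortening.hasWeightDistribution_oddOne hp hF s
    · rintro ⟨k, rfl⟩
      -- Positivity of `m` lets the even case be written as `m = 2(k + 1)`.
      obtain ⟨k, rfl⟩ := Nat.exists_eq_add_of_lt (show 0 < k by omega)
      rw [← two_mul, zero_add] at hF ⊢
      exact CodeShortening.hasWeightDistribution_evenOne hp hF s
  · obtain ⟨s, t, hst, rfl⟩ := Finset.card_eq_two.mp hT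
    refine ⟨⟨by rw [CodeShortening.card_not_mem hF, hT],
      CodeShortening.finrank_shorten_pair hp hF hst⟩, ?_, ?_⟩
    · rintro ⟨k, rfl⟩
      exact CodeShortening.hasWeightDistribution_oddTwo hp hF hst
    · rintro ⟨k, rfl⟩
      obtain ⟨k, rfl⟩ := Nat.exists_eq_add_of_lt (show 0 < k by omega)
      rw [← two_mul, zero_add] at hF ⊢
      exact CodeShortening.hasWeightDistribution_evenTwo hp hF hst
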